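/- Consider coloured integers $k_z$ with $k\ge 1$ an integer and $z$ one of the four colours $a,b,c,d$, ordered by $$1_a<1_b<1_c<1_d<2_a<2_b<2_c<2_d<\cdots.$$ Let $$D=\begin{pmatrix}2&1&2&2\\1&0&1&1\\0&1&0&2\\0&1&0&2\end{pmatrix},$$ with rows and columns indexed by $a,b,c,d$ in this order. Consider finite (possibly empty) sequences $(\lambda_1,\lambda_2,\dots,\lambda_s)$ of coloured integers, weakly decreasing in the above order, such that for all $1\le i<s$, if $\lambda_i$ has colour $x$ and $\lambda_{i+1}$ has colour $y$, then the size of $\lambda_i$ minus the size of $\lambda_{i+1}$ is at least the entry $D(x,y)$ in row $x$ and column $y$. For integers $n,k,\ell,m\ge 0$ let $A(n;k,\ell,m)$ be the (finite) number of such sequences whose sizes sum to $n$ and which have exactly $k$ parts coloured $a$, $\ell$ parts coloured $c$ and $m$ parts coloured $d$ (and any number of parts coloured $b$). Then, as formal power series in $q,a,c,d$, $$\sum_{n,k,\ell,m\ge 0}A(n;k,\ell,m)\,q^n a^k c^\ell d^m=\frac{(-aq;q^2)_\infty(-dq;q^2)_\infty}{(q;q)_\infty(cq;q^2)_\infty},$$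 where $(x;y)_\infty=\prod_{j\ge 0}(1-xy^j)$. -/

import Mathlib

open scoped MvPowerSeries.WithPiTopology

namespace PrimcPartition

/-- The four colours. -/
inductive Colour : Type
  | a | b | c | d
  deriving DecidableEq

/-- The rank of a colour in the order `a < b < c < d` (used for parts of equal size). -/
def Colour.rank : Colour → ℕ
  | .a => 0
  | .b => 1
  | .c => 2
  | .d => 3

/-- A coloured integer `k_z`: the size `k` together with the colour `z`. -/
structure Part : Type where
  size : ℕ
  colour : Colour
  deriving DecidableEq

/-- The order `1_a < 1_b < 1_c < 1_d < 2_a < 2_b < 2_c < 2_d < ⋯`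
(non-strict version). -/
def Part.le (x y : Part) : Prop :=
  x.size < y.size ∨ (x.size = y.size ∧ x.colour.rank ≤ y.colour.rank)

/-- The matrix of minimal differences: row `x` is the colour of the larger part `λ_i`,
column `y` is the colour of the following part `λ_{i+1}`. -/
def D : Colour → Colour → ℕ
  | .a, .a => 2 | .a, .b => 1 | .a, .c => 2 | .a, .d => 2
  | .b, .a => 1 | .b, .b => 0 | .b, .c => 1 | .b, .d => 1
  | .c, .a => 0 | .c, .b => 1 | .c, .c => 0 | .c, .d => 2
  | .d, .a => 0 | .d, .b => 1 | .d, .c => 0 | .d, .d => 2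

/-- A finite list `(λ_1, λ_2, …)` of coloured integers is a four-coloured partition with
difference conditions `D`: its parts are positive, it is weakly decreasing in the order of
coloured integers, and `λ_i - λ_{i+1} ≥ D(colour of λ_i, colour of λ_{i+1})` for all `i`
(the inequality is written additively). -/
structure IsPartition (l : List Part) : Prop where
  pos : ∀ x ∈ l, 1 ≤ x.size
  decreasing : l.Pairwise (fun x y => y.le x)
  difference : l.IsChain (fun x y => y.size + D x.colour y.colour ≤ x.size)

/-- The number of parts of colour `z`. -/
def count (z : Colour) (l : List Part) : ℕ :=
  l.countP (fun x => decide (x.colour = z))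

/-- The partitions of `n` satisfying the difference conditions, with `k` parts coloured `a`,
`ℓ` parts coloured `c` and `m` parts coloured `d` (and any number of parts coloured `b`). -/
def partitions (n k ℓ m : ℕ) : Set (List Part) :=
  {l | IsPartition l ∧ (l.map Part.size).sum = n ∧
    count .a l = k ∧ count .c l = ℓ ∧ count .d l = m}

/-- The number `A(n; k, ℓ, m)`. -/
noncomputable def A (n k ℓ m : ℕ) : ℕ := (partitions n k ℓ m).ncard

/-- Names of the four commuting indeterminates. -/
inductive Var : Type
  | q | a | c | d
  deriving DecidableEq

/-- Formal power series in `q, a, c, d` with integer coefficients. The topology on it is that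
of coefficientwise convergence (`ℤ` being discrete). -/
abbrev Series : Type := MvPowerSeries Var ℤ

/-- An indeterminate as a power series. -/
noncomputable abbrev q : Series := MvPowerSeries.X Var.q
/-- An indeterminate as a power series. -/
noncomputable abbrev a : Series := MvPowerSeries.X Var.a
/-- An indeterminate as a power series. -/
noncomputable abbrev c : Series := MvPowerSeries.X Var.c
/-- An indeterminate as a power series. -/
noncomputable abbrev d : Series := MvPowerSeries.X Var.d

/-- The generating function `∑ A(n; k, ℓ, m) q^n a^k c^ℓ d^m`: the power series in which the
monomial `q^n a^k c^ℓ d^m` has coefficient `A(n; k, ℓ, m)`. -/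
noncomputable def genFun : Series :=
  fun e => (A (e Var.q) (e Var.a) (e Var.c) (e Var.d) : ℤ)

/-- The factors `1 - x y^j`, `j = 0, 1, 2, …`, of `(x; y)_∞`. -/
noncomputable def qFactor (x y : Series) (j : ℕ) : Series := 1 - x * y ^ j

/-- The infinite product `(x; y)_∞ = ∏_{j ≥ 0} (1 - x y^j)`. -/
noncomputable def qPoch (x y : Series) : Series := ∏' j : ℕ, qFactor x y j

end PrimcPartition

/-!
Let `B_m` and `F_m` be the generating functions of the partitions whose largest part may follow
`m_b`, respectively `m_c`. Removing the largest part gives a pair of linear `q`-difference equations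
for `∑ B_m x^m` and `∑ F_m x^m`. After division by `(-x; q)_∞` the system only couples even
coefficients of the first series to odd coefficients of the second, and it is solved by a product.
The limit of `B_m` is the wanted generating function.

To avoid limits the equations are solved modulo `q^N`, where the infinite products are finite and
`B_m` is eventually constant.
-/

namespace PrimcPartition

section FiniteProducts

open Finset

variable {R S : Type*} [CommRing R] [CommRing S]

/-- The finite `q`-Pochhammer symbol `(x; y)_n = ∏_{j < n} (1 - x y^j)` in a commutative ring; the
truncations of `qPoch` and their images in quotient rings are of this form. -/
def finQPoch (x y : R) (n : ℕ) : R := ∏ j ∈ range n, (1 - x * y ^ j)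

@[simp]
lemma finQPoch_zero (x y : R) : finQPoch x y 0 = 1 := prod_range_zero _

@[simp]
lemma finQPoch_zero_left (y : R) (n : ℕ) : finQPoch 0 y n = 1 := by simp [finQPoch]

lemma finQPoch_succ (x y : R) (n : ℕ) :
    finQPoch x y (n + 1) = finQPoch x y n * (1 - x * y ^ n) :=
  prod_range_succ _ n

lemma finQPoch_succ' (x y : R) (n : ℕ) :
    finQPoch x y (n + 1) = (1 - x) * finQPoch (x * y) y n := by
  simp only [finQPoch, prod_range_succ', pow_zero, mul_one, pow_succ', mul_assoc, mul_comm (1 - x)]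

lemma map_finQPoch (φ : R →+* S) (x y : R) (n : ℕ) :
    φ (finQPoch x y n) = finQPoch (φ x) (φ y) n := by
  simp only [finQPoch, map_prod, map_sub, map_one, map_mul, map_pow]

lemma finQPoch_mul_finQPoch_neg (x y : R) (n : ℕ) :
    finQPoch x y n * finQPoch (-x) y n = finQPoch (x ^ 2) (y ^ 2) n := by
  simp only [finQPoch, ← prod_mul_distrib]
  exact prod_congr rfl fun j _ => by ring

lemma finQPoch_eq_of_pow_eq_zero {y : R} {N n : ℕ} (x : R) (hy : y ^ N = 0) (hn : N ≤ n) :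
    finQPoch x y n = finQPoch x y N := by
  induction n, hn using Nat.le_induction with
  | base => rfl
  | succ n hn ih => rw [finQPoch_succ, pow_eq_zero_of_le hn hy, mul_zero, sub_zero, mul_one, ih]

lemma finQPoch_eq_one_sub_mul {y : R} {N : ℕ} (x : R) (hy : y ^ N = 0) :
    finQPoch x y N = (1 - x) * finQPoch (x * y) y N := by
  rw [← finQPoch_succ', finQPoch_eq_of_pow_eq_zero x hy N.le_succ]

end FiniteProducts

section QDifference

open Filter PowerSeries

variable {R S : Type*} [CommRing R] [CommRing S]

lemma rescale_C (q r : R) : rescale q (C r) = C r := by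
  ext n
  cases n <;> simp [coeff_C]

lemma isUnit_finQPoch {x : R⟦X⟧} (hx : constantCoeff x = 0) (y : R⟦X⟧) (n : ℕ) :
    IsUnit (finQPoch x y n) := by
  rw [isUnit_iff_constantCoeff, map_finQPoch, hx, finQPoch_zero_left]
  exact isUnit_one

lemma eventually_coeff_one_sub_mul {f : R⟦X⟧} {s : R} (u : R)
    (hf : ∀ᶠ n in atTop, coeff n f = s) :
    ∀ᶠ n in atTop, coeff n ((1 - C u * X) * f) = (1 - u) * s := by
  obtain ⟨M, hM⟩ := eventually_atTop.1 hf
  refine eventually_atTop.2 ⟨M + 1, fun n hn => ?_⟩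
  obtain ⟨n, rfl⟩ := Nat.exists_eq_add_one.2 (Nat.zero_lt_of_lt hn)
  simp only [sub_mul, one_mul, mul_assoc, map_sub, coeff_C_mul, coeff_succ_X_mul]
  rw [hM n (by lia), hM (n + 1) (by lia)]

lemma eventually_coeff_finQPoch_mul {f : R⟦X⟧} {s : R} (u y : R) (N : ℕ)
    (hf : ∀ᶠ n in atTop, coeff n f = s) :
    ∀ᶠ n in atTop, coeff n (finQPoch (C u * X) (C y) N * f) = finQPoch u y N * s := by
  induction N with
  | zero => simpa using hf
  | succ N ih =>
    have hsucc : finQPoch (C u * X) (C y) (N + 1) * f =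
        (1 - C (u * y ^ N) * X) * (finQPoch (C u * X) (C y) N * f) := by
      rw [finQPoch_succ, map_mul, map_pow]
      ring
    rw [hsucc, finQPoch_succ, mul_comm (finQPoch u y N), mul_assoc]
    exact eventually_coeff_one_sub_mul (u * y ^ N) ih

/-- The `q`-difference system satisfied by the generating series `B = ∑ B_m x^m` and
`F = ∑ F_m x^m` of the partitions whose largest part may follow `m_b`, respectively `m_c`, except
that `F_0 = 0`. -/
structure IsSolution (q a c d : R) (B F : R⟦X⟧) : Prop where
  constantCoeff_left : constantCoeff B = 1
  constantCoeff_right : constantCoeff F = 0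
  left : (1 - X) * B = (1 + C (a * q) * X ^ 2) * rescale q B + C (c + d) * X * rescale q F
  right : F = (C c - C d * X) * rescale q F + C (a * q) * X * rescale q B + B - rescale q B

/-- The system obtained from `IsSolution` by dividing `B` and `F` by `(-x; q)_∞`. It relates only
coefficients of `Y` and `Z` at distance two and those of `Y` to neighbouring ones of `Z`, which
makes it solvable by a product. -/
structure IsReducedSolution (q a c d : R) (Y Z : R⟦X⟧) : Prop where
  constantCoeff_left : constantCoeff Y = 1
  constantCoeff_right : constantCoeff Z = 0
  left : (1 - X ^ 2) * Y = (1 + C (a * q) * X ^ 2) * rescale q Y + C (c + d) * X * rescale q Z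
  right : (1 - X ^ 2) * Z = C (1 + a * q) * X * rescale q Y + (C c + C d * X ^ 2) * rescale q Z

variable {q a c d : R} {B F Y Z : R⟦X⟧} {N : ℕ}

lemma IsSolution.of_coeff (hB : constantCoeff B = 1) (hF : constantCoeff F = 0)
    (hone : (1 - q) * coeff 1 B = 1)
    (hleft : ∀ m, (1 - q ^ (m + 2)) * coeff (m + 2) B = coeff (m + 1) B +
      a * q ^ (m + 1) * coeff m B + (c + d) * q ^ (m + 1) * coeff (m + 1) F)
    (hright : ∀ m, (1 - c * q ^ (m + 1)) * coeff (m + 1) F = a * q ^ (m + 1) * coeff m B +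
      (1 - q ^ (m + 1)) * coeff (m + 1) B - d * q ^ m * coeff m F) :
    IsSolution q a c d B F where
  constantCoeff_left := hB
  constantCoeff_right := hF
  left := by
    ext1 m
    obtain _ | _ | m := m
    all_goals
      simp only [sub_mul, add_mul, one_mul, pow_two, mul_assoc, map_sub (coeff _),
        map_add (coeff _), coeff_C_mul, coeff_succ_X_mul, coeff_zero_X_mul, coeff_rescale]
    · ring
    · simp only [zero_add, coeff_zero_eq_constantCoeff, hB, hF]
      linear_combination hone
    · linear_combination hleft m
  right := by
    ext1 m
    obtain _ | m := m
    all_goals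
      simp only [sub_mul, mul_assoc, map_sub (coeff _), map_add (coeff _), coeff_C_mul,
        coeff_succ_X_mul, coeff_zero_X_mul, coeff_rescale]
    · simp only [coeff_zero_eq_constantCoeff, hB, hF]
      ring
    · linear_combination hright m

lemma IsSolution.map (h : IsSolution q a c d B F) (φ : R →+* S) :
    IsSolution (φ q) (φ a) (φ c) (φ d) (PowerSeries.map φ B) (PowerSeries.map φ F) where
  constantCoeff_left := by
    rw [← coeff_zero_eq_constantCoeff_apply, coeff_map, coeff_zero_eq_constantCoeff_apply,
      h.constantCoeff_left, map_one]
  constantCoeff_right := by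
    rw [← coeff_zero_eq_constantCoeff_apply, coeff_map, coeff_zero_eq_constantCoeff_apply,
      h.constantCoeff_right, map_zero]
  left := by simpa [rescale_map] using congrArg (PowerSeries.map φ) h.left
  right := by simpa [rescale_map] using congrArg (PowerSeries.map φ) h.right

-- Since `q ^ N = 0`, the finite product `E` satisfies the equation `E(x) = (1 + x) E(qx)` of
-- `(-x; q)_∞`.
lemma IsSolution.exists_isReducedSolution (h : IsSolution q a c d B F) (hq : q ^ N = 0) :
    ∃ Y Z, IsReducedSolution q a c d Y Z ∧ B = finQPoch (-X) (C q) N * Y := by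
  set E : R⟦X⟧ := finQPoch (-X) (C q) N
  have hE_rescale : rescale q E = finQPoch (-X * C q) (C q) N := by
    simp only [E, map_finQPoch, map_neg, rescale_X, rescale_C, neg_mul, mul_comm]
  have hE : E = (1 + X) * rescale q E := by
    rw [hE_rescale, ← sub_neg_eq_add]
    exact finQPoch_eq_one_sub_mul _ (by rw [← map_pow, hq, map_zero])
  have hE_unit : IsUnit E := isUnit_finQPoch (by simp) _ _
  have hE'_unit : IsUnit (rescale q E) := hE_unit.map _
  have hE_coeff : constantCoeff E = 1 := by simp [E, map_finQPoch]
  obtain ⟨Y, rfl⟩ := hE_unit.dvd (a := B)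
  obtain ⟨Z, rfl⟩ := hE_unit.dvd (a := F)
  obtain ⟨hY, hZ, hleft, hright⟩ := h
  have hleft' : (1 - X ^ 2) * Y =
      (1 + C (a * q) * X ^ 2) * rescale q Y + C (c + d) * X * rescale q Z := by
    apply hE'_unit.mul_left_cancel
    simp only [map_mul (rescale q)] at hleft
    linear_combination hleft - (1 - X) * Y * hE
  refine ⟨Y, Z, ⟨by simpa [hE_coeff] using hY, by simpa [hE_coeff] using hZ, hleft', ?_⟩, rfl⟩
  have hright' : (1 + X) * Z = (C c - C d * X) * rescale q Z +
      C (a * q) * X * rescale q Y + (1 + X) * Y - rescale q Y := by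
    apply hE'_unit.mul_left_cancel
    simp only [map_mul (rescale q)] at hright
    linear_combination hright + (Y - Z) * hE
  simp only [map_add, map_mul, map_one] at hleft' hright' ⊢
  linear_combination (1 - X) * hright' + hleft'

namespace IsReducedSolution

lemma mul_coeff_one_left (h : IsReducedSolution q a c d Y Z) : (1 - q) * coeff 1 Y = 0 := by
  have hcoeff := congrArg (coeff (0 + 1)) h.left
  simp only [sub_mul, add_mul, one_mul, pow_two, mul_assoc, map_sub, map_add (coeff _), coeff_C_mul,
    coeff_succ_X_mul, coeff_zero_X_mul, coeff_rescale, coeff_zero_eq_constantCoeff,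
    h.constantCoeff_right] at hcoeff
  linear_combination hcoeff

lemma mul_coeff_one_right (h : IsReducedSolution q a c d Y Z) :
    (1 - c * q) * coeff 1 Z = 1 + a * q := by
  have hcoeff := congrArg (coeff (0 + 1)) h.right
  simp only [sub_mul, add_mul, one_mul, pow_two, mul_assoc, map_sub, map_add (coeff _), coeff_C_mul,
    coeff_succ_X_mul, coeff_zero_X_mul, coeff_rescale, coeff_zero_eq_constantCoeff,
    h.constantCoeff_left] at hcoeff
  linear_combination hcoeff

lemma mul_coeff_add_two_left (h : IsReducedSolution q a c d Y Z) (n : ℕ) :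
    (1 - q ^ (n + 2)) * coeff (n + 2) Y =
      (1 + a * q ^ (n + 1)) * coeff n Y + (c + d) * q ^ (n + 1) * coeff (n + 1) Z := by
  have hcoeff := congrArg (coeff (n + 1 + 1)) h.left
  simp only [sub_mul, add_mul, one_mul, pow_two, mul_assoc, map_sub, map_add (coeff _), coeff_C_mul,
    coeff_succ_X_mul, coeff_rescale] at hcoeff
  linear_combination hcoeff

lemma mul_coeff_add_two_right (h : IsReducedSolution q a c d Y Z) (n : ℕ) :
    (1 - c * q ^ (n + 2)) * coeff (n + 2) Z =
      (1 + d * q ^ n) * coeff n Z + (1 + a * q) * q ^ (n + 1) * coeff (n + 1) Y := by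
  have hcoeff := congrArg (coeff (n + 1 + 1)) h.right
  simp only [sub_mul, add_mul, one_mul, pow_two, mul_assoc, map_sub, map_add (coeff _), coeff_C_mul,
    coeff_succ_X_mul, coeff_rescale] at hcoeff
  linear_combination hcoeff

lemma mul_coeff_odd_right_and_mul_coeff_even_left (h : IsReducedSolution q a c d Y Z) (n : ℕ) :
    (1 - c * q ^ (2 * n + 1)) * coeff (2 * n + 1) Z =
        (1 + a * q ^ (2 * n + 1)) * coeff (2 * n) Y ∧
      (1 - q ^ (2 * n + 2)) * coeff (2 * n + 2) Y =
        (1 + d * q ^ (2 * n + 1)) * coeff (2 * n + 1) Z := by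
  have left_of_right {n : ℕ} (hn : (1 - c * q ^ (2 * n + 1)) * coeff (2 * n + 1) Z =
      (1 + a * q ^ (2 * n + 1)) * coeff (2 * n) Y) : (1 - q ^ (2 * n + 2)) * coeff (2 * n + 2) Y =
        (1 + d * q ^ (2 * n + 1)) * coeff (2 * n + 1) Z := by
    linear_combination h.mul_coeff_add_two_left (2 * n) - hn
  suffices hright : (1 - c * q ^ (2 * n + 1)) * coeff (2 * n + 1) Z =
      (1 + a * q ^ (2 * n + 1)) * coeff (2 * n) Y from ⟨hright, left_of_right hright⟩
  induction n with
  | zero => simpa [h.constantCoeff_left] using h.mul_coeff_one_right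
  | succ n ih =>
    rw [show 2 * (n + 1) = 2 * n + 2 by ring]
    linear_combination h.mul_coeff_add_two_right (2 * n + 1) - left_of_right ih

lemma coeff_even_mul_finQPoch (h : IsReducedSolution q a c d Y Z) (n : ℕ) :
    coeff (2 * n) Y * (finQPoch (q ^ 2) (q ^ 2) n * finQPoch (c * q) (q ^ 2) n) =
      finQPoch (-(a * q)) (q ^ 2) n * finQPoch (-(d * q)) (q ^ 2) n := by
  induction n with
  | zero => simp [h.constantCoeff_left]
  | succ n ih =>
    obtain ⟨hZ, hY⟩ := h.mul_coeff_odd_right_and_mul_coeff_even_left n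
    simp only [finQPoch_succ, ← pow_mul]
    rw [show 2 * (n + 1) = 2 * n + 2 by ring]
    linear_combination (1 + a * q ^ (2 * n + 1)) * (1 + d * q ^ (2 * n + 1)) * ih +
      finQPoch (q ^ 2) (q ^ 2) n * finQPoch (c * q) (q ^ 2) n *
        ((1 - c * q ^ (2 * n + 1)) * hY + (1 + d * q ^ (2 * n + 1)) * hZ)

lemma coeff_odd_left_and_coeff_even_right (h : IsReducedSolution q a c d Y Z)
    (hq : IsNilpotent q) (n : ℕ) : coeff (2 * n + 1) Y = 0 ∧ coeff (2 * n) Z = 0 := by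
  have isUnit_one_sub (r : R) (k : ℕ) : IsUnit (1 - r * q ^ (k + 1)) :=
    ((Commute.all _ _).isNilpotent_mul_left (hq.pow_succ k)).isUnit_one_sub
  induction n with
  | zero =>
    refine ⟨(isUnit_one_sub 1 0).mul_left_cancel ?_, by simpa using h.constantCoeff_right⟩
    simpa using h.mul_coeff_one_left
  | succ n ih =>
    obtain ⟨hY, hZ⟩ := ih
    have hZ' : coeff (2 * (n + 1)) Z = 0 := by
      apply (isUnit_one_sub c (2 * n + 1)).mul_left_cancel
      linear_combination h.mul_coeff_add_two_right (2 * n) + (1 + d * q ^ (2 * n)) * hZ +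
        (1 + a * q) * q ^ (2 * n + 1) * hY
    refine ⟨(isUnit_one_sub 1 (2 * n + 2)).mul_left_cancel ?_, hZ'⟩
    linear_combination h.mul_coeff_add_two_left (2 * n + 1) +
      (1 + a * q ^ (2 * n + 2)) * hY + (c + d) * q ^ (2 * n + 2) * hZ'

lemma coeff_even_left_of_le (h : IsReducedSolution q a c d Y Z) (hq : q ^ N = 0) {n : ℕ}
    (hn : N ≤ n) : coeff (2 * n) Y = coeff (2 * N) Y := by
  induction n, hn using Nat.le_induction with
  | base => rfl
  | succ n hn ih =>
    obtain ⟨hZ, hY⟩ := h.mul_coeff_odd_right_and_mul_coeff_even_left n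
    have hpow (k : ℕ) : q ^ (2 * n + k) = 0 := pow_eq_zero_of_le (by lia) hq
    simp only [hpow, mul_zero, sub_zero, add_zero, one_mul] at hZ hY
    rw [← ih, ← hZ, ← hY, mul_add_one]

lemma eventually_coeff_one_add_X_mul (h : IsReducedSolution q a c d Y Z) (hq : q ^ N = 0) :
    ∀ᶠ n in atTop, coeff n ((1 + X) * Y) = coeff (2 * N) Y := by
  have hodd (k : ℕ) : coeff (2 * k + 1) Y = 0 :=
    (h.coeff_odd_left_and_coeff_even_right ⟨N, hq⟩ k).1
  refine eventually_atTop.2 ⟨2 * N + 1, fun n hn => ?_⟩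
  obtain ⟨k, rfl | rfl⟩ := Nat.even_or_odd' n
  · obtain ⟨k, rfl⟩ := Nat.exists_eq_add_one.2 (show 0 < k by lia)
    rw [add_mul, one_mul, map_add, mul_add_one 2 k, coeff_succ_X_mul, hodd, add_zero]
    exact h.coeff_even_left_of_le hq (n := k + 1) (by lia)
  · rw [add_mul, one_mul, map_add, coeff_succ_X_mul, hodd, zero_add]
    exact h.coeff_even_left_of_le hq (by lia)

end IsReducedSolution

lemma IsSolution.eventually_coeff_mul_finQPoch (h : IsSolution q a c d B F) (hq : q ^ N = 0) :
    ∀ᶠ m in atTop, coeff m B * (finQPoch q q N * finQPoch (c * q) (q ^ 2) N) =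
      finQPoch (-(a * q)) (q ^ 2) N * finQPoch (-(d * q)) (q ^ 2) N := by
  obtain ⟨Y, Z, hYZ, rfl⟩ := h.exists_isReducedSolution hq
  have hB : finQPoch (-X) (C q) N * Y = finQPoch (C (-q) * X) (C q) N * ((1 + X) * Y) := by
    rw [finQPoch_eq_one_sub_mul (-X) (by rw [← map_pow, hq, map_zero]), map_neg, neg_mul, neg_mul,
      mul_comm X]
    ring
  filter_upwards [eventually_coeff_finQPoch_mul (-q) q N (hYZ.eventually_coeff_one_add_X_mul hq)]
    with m hm
  rw [hB, hm, ← hYZ.coeff_even_mul_finQPoch N, ← finQPoch_mul_finQPoch_neg]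
  ring

end QDifference

section Enumerator

open MvPowerSeries

variable {α β σ R : Type*} [Semiring R]

/-- The generating function `∑_{x ∈ S} X^(w x)` of a set `S` whose elements are weighted by
exponents. The definition is meant for sets with finitely many elements of each weight: an infinite
fibre contributes `0`, by the convention of `Set.ncard`. -/
noncomputable def enumerator (R : Type*) [Semiring R] (w : α → σ →₀ ℕ) (S : Set α) :
    MvPowerSeries σ R :=
  fun e => ({x ∈ S | w x = e}.ncard : R)

lemma coeff_enumerator (w : α → σ →₀ ℕ) (S : Set α) (e : σ →₀ ℕ) :
    coeff e (enumerator R w S) = ({x ∈ S | w x = e}.ncard : R) :=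
  rfl

@[simp]
lemma enumerator_empty (w : α → σ →₀ ℕ) : enumerator R w ∅ = 0 := by
  ext e
  simp [coeff_enumerator]

@[simp]
lemma enumerator_singleton (w : α → σ →₀ ℕ) (x : α) :
    enumerator R w {x} = monomial (w x) 1 := by
  classical
  ext e
  rw [coeff_enumerator, coeff_monomial]
  split_ifs with he
  · have hsep : {y ∈ ({x} : Set α) | w y = e} = {x} :=
      Set.sep_eq_self_iff_mem_true.2 fun _ hy => hy ▸ he.symm
    rw [hsep, Set.ncard_singleton, Nat.cast_one]
  · have hsep : {y ∈ ({x} : Set α) | w y = e} = ∅ :=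
      Set.sep_eq_empty_iff_mem_false.2 fun _ hy hye => he (hye.symm.trans (hy ▸ rfl))
    rw [hsep, Set.ncard_empty, Nat.cast_zero]

lemma enumerator_union {w : α → σ →₀ ℕ} {S T : Set α} (hST : Disjoint S T)
    (hS : ∀ e, {x ∈ S | w x = e}.Finite) (hT : ∀ e, {x ∈ T | w x = e}.Finite) :
    enumerator R w (S ∪ T) = enumerator R w S + enumerator R w T := by
  ext e
  have hsep : {x ∈ S ∪ T | w x = e} = {x ∈ S | w x = e} ∪ {x ∈ T | w x = e} :=
    Set.union_inter_distrib_right S T _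
  rw [map_add, coeff_enumerator, hsep,
    Set.ncard_union_eq (hST.mono (Set.sep_subset _ _) (Set.sep_subset _ _)) (hS e) (hT e),
    Nat.cast_add, coeff_enumerator, coeff_enumerator]

lemma enumerator_image {w : α → σ →₀ ℕ} {w' : β → σ →₀ ℕ} {f : α → β} (hf : f.Injective)
    {u : σ →₀ ℕ} (hw : ∀ x, w' (f x) = u + w x) (S : Set α) :
    enumerator R w' (f '' S) = monomial u 1 * enumerator R w S := by
  classical
  ext e
  rw [coeff_monomial_mul, one_mul, coeff_enumerator, coeff_enumerator]
  split_ifs with he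
  · rw [← Set.ncard_image_of_injective _ hf]
    congr 2
    ext y
    constructor
    · rintro ⟨⟨x, hx, rfl⟩, hxe⟩
      exact ⟨x, ⟨hx, by rw [← hxe, hw, add_tsub_cancel_left]⟩, rfl⟩
    · rintro ⟨x, ⟨hx, hxe⟩, rfl⟩
      exact ⟨⟨x, hx, rfl⟩, by rw [hw, hxe, add_tsub_cancel_of_le he]⟩
  · have hempty : {y ∈ f '' S | w' y = e} = ∅ := by
      refine Set.sep_eq_empty_iff_mem_false.2 ?_
      rintro _ ⟨x, -, rfl⟩ rfl
      exact he (hw x ▸ le_self_add)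
    rw [hempty, Set.ncard_empty, Nat.cast_zero]

end Enumerator

section Partitions

open MvPowerSeries

/-- The exponent recording a colour: `b` is not counted in `genFun`, hence has exponent `0`. -/
noncomputable def Colour.weight : Colour → (Var →₀ ℕ)
  | .a => Finsupp.single Var.a 1
  | .b => 0
  | .c => Finsupp.single Var.c 1
  | .d => Finsupp.single Var.d 1

/-- The exponent of the monomial with which a list of parts is counted in `genFun`. -/
noncomputable def weight (l : List Part) : Var →₀ ℕ :=
  (l.map fun x => Finsupp.single Var.q x.size + x.colour.weight).sum

/-- The coloured integers which may follow the part `x` in a partition. Parts of size `0` are not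
excluded here. -/
def followers (x : Part) : Set Part := {y | y.le x ∧ y.size + D x.colour y.colour ≤ x.size}

lemma Part.le_trans {x y z : Part} (hxy : x.le y) (hyz : y.le z) : x.le z := by
  unfold Part.le at *
  lia

lemma isPartition_nil : IsPartition [] :=
  ⟨by simp, List.Pairwise.nil, List.isChain_nil⟩

lemma isPartition_cons {x : Part} {l : List Part} :
    IsPartition (x :: l) ↔ 1 ≤ x.size ∧ IsPartition l ∧ ∀ y ∈ l.head?, y ∈ followers x := by
  have : IsTrans Part fun x y => y.le x := ⟨fun _ _ _ hxy hyz => Part.le_trans hyz hxy⟩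
  constructor
  · rintro ⟨hpos, hdec, hdiff⟩
    rw [List.forall_mem_cons] at hpos
    rw [List.pairwise_cons] at hdec
    rw [List.isChain_cons] at hdiff
    exact ⟨hpos.1, ⟨hpos.2, hdec.2, hdiff.2⟩,
      fun y hy => ⟨hdec.1 y (List.mem_of_mem_head? hy), hdiff.1 y hy⟩⟩
  · rintro ⟨hx, ⟨hpos, hdec, hdiff⟩, hhead⟩
    refine ⟨List.forall_mem_cons.2 ⟨hx, hpos⟩, ?_,
      List.isChain_cons.2 ⟨fun y hy => (hhead y hy).2, hdiff⟩⟩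
    rw [← List.isChain_iff_pairwise] at hdec ⊢
    exact List.isChain_cons.2 ⟨fun y hy => (hhead y hy).1, hdec⟩

lemma weight_cons (x : Part) (l : List Part) :
    weight (x :: l) = Finsupp.single Var.q x.size + x.colour.weight + weight l := by
  simp [weight]

lemma weight_eq_iff {l : List Part} {e : Var →₀ ℕ} :
    weight l = e ↔ (l.map Part.size).sum = e Var.q ∧ count .a l = e Var.a ∧
      count .c l = e Var.c ∧ count .d l = e Var.d := by
  have hweight : weight l Var.q = (l.map Part.size).sum ∧ weight l Var.a = count .a l ∧
      weight l Var.c = count .c l ∧ weight l Var.d = count .d l := by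
    induction l with
    | nil => simp [weight, count]
    | cons x l ih =>
      obtain ⟨k, z⟩ := x
      unfold count at *
      cases z <;> simp [weight_cons, Colour.weight, ih, add_comm]
  obtain ⟨hq, ha, hc, hd⟩ := hweight
  rw [← hq, ← ha, ← hc, ← hd]
  constructor
  · rintro rfl
    simp
  · rintro ⟨hq, ha, hc, hd⟩
    ext v
    cases v <;> assumption

instance : Fintype Colour := ⟨{.a, .b, .c, .d}, by rintro ⟨⟩ <;> decide⟩

lemma finite_sum_size_eq (n : ℕ) :
    {l : List Part | (∀ x ∈ l, 1 ≤ x.size) ∧ (l.map Part.size).sum = n}.Finite := by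
  induction n using Nat.strong_induction_on with
  | _ n ih =>
    have hfin : (⋃ p : Fin n × Colour, List.cons ⟨p.1 + 1, p.2⟩ '' {l : List Part |
        (∀ x ∈ l, 1 ≤ x.size) ∧ (l.map Part.size).sum = n - (p.1 + 1)}).Finite :=
      Set.finite_iUnion fun p => (ih _ (by lia)).image _
    refine (hfin.insert []).subset ?_
    rintro (_ | ⟨⟨k, z⟩, l⟩) ⟨hpos, hsum⟩
    · exact Set.mem_insert _ _
    · rw [List.forall_mem_cons] at hpos
      rw [List.map_cons, List.sum_cons] at hsum
      obtain ⟨k, rfl⟩ := Nat.exists_eq_add_one.2 hpos.1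
      exact .inr (Set.mem_iUnion.2 ⟨(⟨k, by lia⟩, z), l, ⟨hpos.2, by lia⟩, rfl⟩)

lemma finite_partitions (n k ℓ m : ℕ) : (partitions n k ℓ m).Finite :=
  (finite_sum_size_eq n).subset fun _ h => ⟨h.1.pos, h.2.1⟩

lemma finite_isPartition_weight_eq (e : Var →₀ ℕ) : {l | IsPartition l ∧ weight l = e}.Finite :=
  (finite_sum_size_eq (e Var.q)).subset fun _ h => ⟨h.1.pos, (weight_eq_iff.1 h.2).1⟩

lemma genFun_eq_enumerator : genFun = enumerator ℤ weight {l | IsPartition l} := by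
  ext e
  rw [coeff_enumerator]
  simp only [Set.mem_ofPred_eq, weight_eq_iff]
  rfl

/-- The generating function of the partitions which are empty or have their largest part in `Q`. -/
noncomputable def headGF (Q : Set Part) : Series :=
  enumerator ℤ weight {l | IsPartition l ∧ ∀ y ∈ l.head?, y ∈ Q}

/-- The generating function of the partitions with largest part `x`. -/
noncomputable def startGF (x : Part) : Series :=
  enumerator ℤ weight {l | IsPartition l ∧ l.head? = some x}

lemma headGF_insert {x : Part} {Q : Set Part} (hx : x ∉ Q) :
    headGF (insert x Q) = headGF Q + startGF x := by
  rw [headGF, headGF, startGF, ← enumerator_union]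
  · congr 1
    ext l
    rcases l with _ | ⟨y, l⟩ <;> simp [and_or_left, or_comm]
  · exact Set.disjoint_left.2 fun l hl hl' => hx (hl.2 x hl'.2)
  all_goals exact fun e => (finite_isPartition_weight_eq e).subset fun l hl => ⟨hl.1.1, hl.2⟩

lemma headGF_eq_one {Q : Set Part} (hQ : ∀ y ∈ Q, y.size = 0) : headGF Q = 1 := by
  have hnil : {l | IsPartition l ∧ ∀ y ∈ l.head?, y ∈ Q} = {[]} := by
    ext l
    rcases l with _ | ⟨y, l⟩
    · simp [isPartition_nil]
    · have hcons : IsPartition (y :: l) → y ∉ Q := fun hl hy =>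
        Nat.ne_zero_of_lt (hl.pos y List.mem_cons_self) (hQ y hy)
      simpa using hcons
  rw [headGF, hnil, enumerator_singleton]
  rfl

lemma startGF_zero (z : Colour) : startGF ⟨0, z⟩ = 0 := by
  have hempty : {l | IsPartition l ∧ l.head? = some ⟨0, z⟩} = ∅ :=
    Set.eq_empty_of_forall_notMem fun l ⟨hl, hhead⟩ =>
      Nat.not_succ_le_zero 0 (hl.pos _ (List.mem_of_mem_head? hhead))
  rw [startGF, hempty, enumerator_empty]

lemma startGF_succ (k : ℕ) (z : Colour) :
    startGF ⟨k + 1, z⟩ = monomial z.weight 1 * q ^ (k + 1) * headGF (followers ⟨k + 1, z⟩) := by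
  have himage : {l | IsPartition l ∧ l.head? = some ⟨k + 1, z⟩} = List.cons ⟨k + 1, z⟩ ''
      {l | IsPartition l ∧ ∀ y ∈ l.head?, y ∈ followers ⟨k + 1, z⟩} := by
    ext l
    rcases l with _ | ⟨y, l⟩
    · simp
    · simp only [Set.mem_ofPred_eq, List.head?_cons, Option.some.injEq, Set.mem_image,
        List.cons.injEq, exists_eq_right_right, isPartition_cons]
      constructor
      · rintro ⟨⟨-, hl⟩, rfl⟩
        exact ⟨hl, rfl⟩
      · rintro ⟨hl, rfl⟩
        exact ⟨⟨Nat.le_add_left 1 k, hl⟩, rfl⟩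
  rw [startGF, himage, enumerator_image List.cons_injective (weight_cons _), headGF, X_pow_eq,
    monomial_mul_monomial, mul_one, add_comm]

lemma followers_b (m : ℕ) : followers ⟨m, .b⟩ = insert ⟨m, .b⟩ {y | y.size < m} := by
  ext ⟨k, z⟩
  cases z <;> simp only [followers, Part.le, D, Colour.rank, Set.mem_insert_iff, Set.mem_ofPred_eq,
    Part.mk.injEq, reduceCtorEq] <;> lia

lemma followers_a_succ (m : ℕ) : followers ⟨m + 1, .a⟩ = followers ⟨m, .b⟩ := by
  ext ⟨k, z⟩
  cases z <;> simp only [followers, Part.le, D, Colour.rank, Set.mem_ofPred_eq] <;> lia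

lemma followers_d (m : ℕ) : followers ⟨m, .d⟩ = followers ⟨m, .c⟩ := by
  ext ⟨k, z⟩
  cases z <;> simp only [followers, Part.le, D, Colour.rank, Set.mem_ofPred_eq] <;> lia

lemma insert_followers_c_succ (m : ℕ) : insert ⟨m, .d⟩ (followers ⟨m + 1, .c⟩) =
    insert ⟨m + 1, .c⟩ (insert ⟨m + 1, .a⟩ {y | y.size < m + 1}) := by
  ext ⟨k, z⟩
  cases z <;> simp only [followers, Part.le, D, Colour.rank, Set.mem_insert_iff, Set.mem_ofPred_eq,
    Part.mk.injEq, reduceCtorEq] <;> lia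

lemma headGF_size_lt_succ (m : ℕ) : headGF {y | y.size < m + 1} = headGF {y | y.size < m} +
    startGF ⟨m, .a⟩ + startGF ⟨m, .b⟩ + startGF ⟨m, .c⟩ + startGF ⟨m, .d⟩ := by
  have hinsert : {y : Part | y.size < m + 1} =
      insert ⟨m, .d⟩ (insert ⟨m, .c⟩ (insert ⟨m, .b⟩ (insert ⟨m, .a⟩ {y | y.size < m}))) := by
    ext ⟨k, z⟩
    cases z <;> simp only [Set.mem_insert_iff, Set.mem_ofPred_eq, Part.mk.injEq,
      reduceCtorEq] <;> lia
  rw [hinsert, headGF_insert (by simp), headGF_insert (by simp), headGF_insert (by simp),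
    headGF_insert (by simp)]

lemma headGF_followers_b (m : ℕ) :
    headGF (followers ⟨m, .b⟩) = headGF {y | y.size < m} + startGF ⟨m, .b⟩ := by
  rw [followers_b, headGF_insert (by simp)]

lemma headGF_followers_c_succ_add (m : ℕ) : headGF (followers ⟨m + 1, .c⟩) + startGF ⟨m, .d⟩ =
    headGF {y | y.size < m + 1} + startGF ⟨m + 1, .a⟩ + startGF ⟨m + 1, .c⟩ := by
  rw [← headGF_insert (by simp [followers, D]), insert_followers_c_succ, headGF_insert (by simp),
    headGF_insert (by simp)]

lemma startGF_a_succ (m : ℕ) :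
    startGF ⟨m + 1, .a⟩ = a * q ^ (m + 1) * headGF (followers ⟨m, .b⟩) := by
  rw [startGF_succ, followers_a_succ]
  rfl

lemma startGF_b_succ (m : ℕ) :
    startGF ⟨m + 1, .b⟩ = q ^ (m + 1) * headGF (followers ⟨m + 1, .b⟩) := by
  rw [startGF_succ, Colour.weight, monomial_zero_one, one_mul]

lemma startGF_c_succ (m : ℕ) :
    startGF ⟨m + 1, .c⟩ = c * q ^ (m + 1) * headGF (followers ⟨m + 1, .c⟩) :=
  startGF_succ m .c

end Partitions

section Recurrences

open PowerSeries

/-- The series `∑ G_m x^m`, where `G_m` is the generating function of the partitions which are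
empty or have their largest part among the followers of `m_z`. -/
noncomputable def followerSeries (z : Colour) : Series⟦X⟧ := mk fun m => headGF (followers ⟨m, z⟩)

lemma coeff_followerSeries (z : Colour) (m : ℕ) :
    coeff m (followerSeries z) = headGF (followers ⟨m, z⟩) :=
  coeff_mk _ _

lemma constantCoeff_followerSeries (z : Colour) : constantCoeff (followerSeries z) = 1 := by
  rw [← coeff_zero_eq_constantCoeff_apply, coeff_followerSeries]
  exact headGF_eq_one fun y hy => Nat.eq_zero_of_le_zero (Nat.le_of_add_right_le hy.2)

lemma constantCoeff_followerSeries_sub_one (z : Colour) :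
    constantCoeff (followerSeries z - 1) = 0 := by
  rw [map_sub, constantCoeff_followerSeries, map_one, sub_self]

lemma coeff_succ_followerSeries_sub_one (z : Colour) (m : ℕ) :
    coeff (m + 1) (followerSeries z - 1) = headGF (followers ⟨m + 1, z⟩) := by
  rw [map_sub, coeff_followerSeries, coeff_one, if_neg m.succ_ne_zero, sub_zero]

lemma startGF_d (m : ℕ) : startGF ⟨m, .d⟩ = d * q ^ m * coeff m (followerSeries .c - 1) := by
  cases m with
  | zero =>
    rw [startGF_zero, coeff_zero_eq_constantCoeff_apply, constantCoeff_followerSeries_sub_one,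
      mul_zero]
  | succ m =>
    rw [startGF_succ, followers_d, coeff_succ_followerSeries_sub_one]
    rfl

lemma headGF_followers_b_sub (m : ℕ) :
    headGF (followers ⟨m + 1, .b⟩) - q ^ (m + 1) * headGF (followers ⟨m + 1, .b⟩) =
      headGF {y | y.size < m + 1} := by
  rw [← startGF_b_succ, headGF_followers_b, add_sub_cancel_right]

lemma headGF_size_lt_add_two (m : ℕ) : headGF {y | y.size < m + 2} =
    headGF (followers ⟨m + 1, .b⟩) + a * q ^ (m + 1) * headGF (followers ⟨m, .b⟩) +
      (c + d) * q ^ (m + 1) * headGF (followers ⟨m + 1, .c⟩) := by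
  rw [headGF_size_lt_succ, headGF_followers_b (m + 1), startGF_a_succ, startGF_c_succ, startGF_d,
    coeff_succ_followerSeries_sub_one]
  ring

lemma isSolution_followerSeries :
    IsSolution q a c d (followerSeries .b) (followerSeries .c - 1) := by
  refine .of_coeff (constantCoeff_followerSeries .b) (constantCoeff_followerSeries_sub_one .c)
    ?_ (fun m => ?_) fun m => ?_
  · have hone : headGF {y | y.size < 0 + 1} = 1 := headGF_eq_one fun y hy => Nat.lt_one_iff.1 hy
    rw [coeff_followerSeries]
    linear_combination headGF_followers_b_sub 0 + hone
  · rw [coeff_succ_followerSeries_sub_one]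
    simp only [coeff_followerSeries]
    linear_combination headGF_followers_b_sub (m + 1) + headGF_size_lt_add_two m
  · have hstep := headGF_followers_c_succ_add m
    rw [startGF_a_succ, startGF_c_succ, startGF_d] at hstep
    rw [coeff_succ_followerSeries_sub_one, coeff_followerSeries, coeff_followerSeries]
    linear_combination hstep - headGF_followers_b_sub m

end Recurrences

section InfiniteProducts

open Filter MvPowerSeries Topology

variable {x y : Series}

lemma multipliable_qFactor (x : Series) (hy : constantCoeff y = 0) :
    Multipliable (qFactor x y) := by
  simp_rw [funext (qFactor.eq_1 x y), sub_eq_add_neg]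
  refine WithPiTopology.multipliable_one_add_of_tendsto_order_atTop_nhds_top ?_
  refine ENat.tendsto_nhds_top_iff_natCast_lt.2 fun n =>
    eventually_atTop.2 ⟨n + 1, fun j hj => ?_⟩
  calc (n : ℕ∞) < j := by exact_mod_cast hj
    _ ≤ (y ^ j).order := le_order_pow_of_constantCoeff_eq_zero j hy
    _ ≤ x.order + (y ^ j).order := le_add_self
    _ ≤ (-(x * y ^ j)).order := by rw [order_neg]; exact le_order_mul

lemma isUnit_qPoch (hx : constantCoeff x = 0) (hy : constantCoeff y = 0) :
    IsUnit (qPoch x y) := by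
  rw [isUnit_iff_constantCoeff, qPoch, (multipliable_qFactor x hy).map_tprod _
    (WithPiTopology.continuous_constantCoeff ℤ)]
  simp [qFactor, hx]

/-- Reduction modulo `q ^ N`, used to turn identities between infinite products and generating
functions into identities between finite ones. -/
noncomputable abbrev modQPow (N : ℕ) : Series →+* Series ⧸ Ideal.span {q ^ N} :=
  Ideal.Quotient.mk _

lemma modQPow_eq_modQPow_iff {N : ℕ} {f g : Series} :
    modQPow N f = modQPow N g ↔
      ∀ e : Var →₀ ℕ, e Var.q < N → coeff e f = coeff e g := by
  simp only [Ideal.Quotient.eq, Ideal.mem_span_singleton, X_pow_dvd_iff, map_sub, sub_eq_zero]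

lemma eq_of_forall_modQPow_eq {f g : Series} (h : ∀ N, modQPow N f = modQPow N g) : f = g := by
  ext e
  exact modQPow_eq_modQPow_iff.1 (h (e Var.q + 1)) e (Nat.lt_succ_self _)

lemma modQPow_pow_eq_zero (hy : q ∣ y) (N : ℕ) : modQPow N y ^ N = 0 := by
  rw [← map_pow, Ideal.Quotient.eq_zero_iff_dvd]
  exact pow_dvd_pow_of_dvd hy N

lemma modQPow_qPoch (x : Series) (hy : q ∣ y) (N : ℕ) :
    modQPow N (qPoch x y) = finQPoch (modQPow N x) (modQPow N y) N := by
  have hy' : constantCoeff y = 0 := by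
    obtain ⟨z, rfl⟩ := hy
    simp
  rw [← map_finQPoch, modQPow_eq_modQPow_iff]
  intro e he
  have hlim := (WithPiTopology.tendsto_iff_coeff_tendsto _ _ _).1
    (multipliable_qFactor x hy').hasProd.tendsto_prod_nat e
  refine tendsto_nhds_unique hlim (tendsto_const_nhds.congr' ?_)
  filter_upwards [eventually_ge_atTop N] with n hn
  refine modQPow_eq_modQPow_iff.1 ?_ e he
  change modQPow N (finQPoch x y N) = modQPow N (finQPoch x y n)
  rw [map_finQPoch, map_finQPoch, finQPoch_eq_of_pow_eq_zero _ (modQPow_pow_eq_zero hy N) hn]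

lemma modQPow_headGF {Q : Set Part} {N : ℕ} (hQ : {y | y.size < N} ⊆ Q) :
    modQPow N (headGF Q) = modQPow N genFun := by
  refine modQPow_eq_modQPow_iff.2 fun e he => ?_
  rw [genFun_eq_enumerator, headGF, coeff_enumerator, coeff_enumerator]
  congr 2
  ext l
  refine ⟨fun hl => ⟨hl.1.1, hl.2⟩, fun hl => ⟨⟨hl.1, fun y hy => hQ ?_⟩, hl.2⟩⟩
  calc y.size ≤ (l.map Part.size).sum :=
        List.single_le_sum (by simp) _ (List.mem_map_of_mem (List.mem_of_mem_head? hy))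
    _ = e Var.q := (weight_eq_iff.1 hl.2).1
    _ < N := he

lemma genFun_mul_qPoch :
    genFun * (qPoch q q * qPoch (c * q) (q ^ 2)) =
      qPoch (-(a * q)) (q ^ 2) * qPoch (-(d * q)) (q ^ 2) := by
  refine eq_of_forall_modQPow_eq fun N => ?_
  have hq2 : q ∣ q ^ 2 := dvd_pow_self q two_ne_zero
  have hlim := (isSolution_followerSeries.map (modQPow N)).eventually_coeff_mul_finQPoch
    (modQPow_pow_eq_zero dvd_rfl N)
  obtain ⟨m, hm, hNm⟩ := (hlim.and (eventually_ge_atTop N)).exists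
  have hgenFun : {y | y.size < N} ⊆ followers ⟨m, .b⟩ := fun y hy => by
    rw [followers_b]
    exact .inr (Nat.lt_of_lt_of_le hy hNm)
  rw [PowerSeries.coeff_map, coeff_followerSeries, modQPow_headGF hgenFun] at hm
  simpa only [map_mul, map_neg, map_pow, modQPow_qPoch _ hq2, modQPow_qPoch _ (dvd_refl q)] using hm

end InfiniteProducts

end PrimcPartition

open PrimcPartition in
theorem theorem1 :
    -- every `A(n; k, ℓ, m)` counts a finite set
    (∀ n k ℓ m : ℕ, (partitions n k ℓ m).Finite) ∧
    -- the four infinite products converge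
    (Multipliable (qFactor (-(a * q)) (q ^ 2)) ∧ Multipliable (qFactor (-(d * q)) (q ^ 2)) ∧
      Multipliable (qFactor q q) ∧ Multipliable (qFactor (c * q) (q ^ 2))) ∧
    -- the denominator is invertible
    IsUnit (qPoch q q * qPoch (c * q) (q ^ 2)) ∧
    -- the identity
    genFun = qPoch (-(a * q)) (q ^ 2) * qPoch (-(d * q)) (q ^ 2) *
      Ring.inverse (qPoch q q * qPoch (c * q) (q ^ 2)) := by
  have hq : MvPowerSeries.constantCoeff q = 0 := MvPowerSeries.constantCoeff_X Var.q
  have hq2 : MvPowerSeries.constantCoeff (q ^ 2) = 0 := by simp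
  have hcq : MvPowerSeries.constantCoeff (c * q) = 0 := by simp
  have hunit : IsUnit (qPoch q q * qPoch (c * q) (q ^ 2)) :=
    (isUnit_qPoch hq hq).mul (isUnit_qPoch hcq hq2)
  refine ⟨finite_partitions, ⟨multipliable_qFactor _ hq2, multipliable_qFactor _ hq2,
    multipliable_qFactor _ hq, multipliable_qFactor _ hq2⟩, hunit, ?_⟩
  rw [← genFun_mul_qPoch, mul_assoc, Ring.mul_inverse_cancel _ hunit, mul_one]
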